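/- Let $n\ge 2$ and let $G\varsubsetneq\mathbb{R}^n$ be a proper subdomain, i.e. a nonempty connected open set with $G\ne\mathbb{R}^n$. Write $\delta(x)$ for the Euclidean distance from $x$ to $\partial G$, $\ell(\gamma)$ for the Euclidean length of a path $\gamma$, and for $x,y\in G$ let $$\alpha_G(x,y)=\sup_{a,b\in\partial G}\log\frac{|a-y|\,|b-x|}{|a-x|\,|b-y|},\qquad j_G(x,y)=\log\Bigl(1+\frac{|x-y|}{\min\{\delta(x),\delta(y)\}}\Bigr),\qquad k_G(x,y)=\inf_\gamma\int_\gamma\frac{|dz|}{\delta(z)},$$ where in $\alpha_G$ the boundary is taken in $\mathbb{R}^n\cup\{\infty\}$ (with $|\infty-x|/|\infty-y|=1$), and the infimum in $k_G$ is over all rectifiable paths $\gamma$ joining $x$ and $y$ in $G$. Let $\tilde\alpha_G(x,y)=\inf_\gamma\alpha_G(\gamma)$ be the inner metric of $\alpha_G$, where the infimum is over the same paths, $\gamma:[0,1]\to G$, and $\alpha_G(\gamma)=\sup\sum_{i=0}^{k-1}\alpha_G(\gamma(t_i),\gamma(t_{i+1}))$, the supremum being over all $k$ and all $0=t_0<t_1<\dots<t_k=1$.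 For distance functions $d,d'$ on $G$ write $d\lesssim d'$ if $d\le K d'$ on $G\times G$ for some constant $K>0$; $d\approx d'$ if $d\lesssim d'$ and $d'\lesssim d$; and $d\ll d'$ if $d\lesssim d'$ but not $d'\lesssim d$. The domain $G$ is called * *quasi-isotropic* if there is a constant $K$ such that for every $x\in G$ $$\limsup_{r\to0^+}\frac{\sup\{\alpha_G(x,z):|x-z|=r\}}{\inf\{\alpha_G(x,y):|x-y|=r\}}\le K,$$ where the quotient is $\infty$ if the denominator is $0$ and the numerator is not; * *uniform* if there is a constant $K$ such that any $x,y\in G$ can be joined by a path $\gamma$ in $G$, parameterized by arc length, with $\ell(\gamma)\le K|x-y|$ and $K\,\delta(\gamma(t))\ge\min\{t,\ell(\gamma)-t\}$ for all $t\in[0,\ell(\gamma)]$. Then: 1. If $G$ is quasi-isotropic and uniform, then $G$ has the comparison property, that is, $\alpha_G\approx j_G$. 2. The inequality $\alpha_G\ll j_G\approx\tilde\alpha_G\approx k_G$ does not hold (in any proper subdomain $G$ of $\mathbb{R}^n$). -/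

import Mathlib

open Set Filter Topology MeasureTheory
open scoped NNReal ENNReal

noncomputable section

namespace HyperbolicType

/-- A proper subdomain of `ℝⁿ`: a nonempty, connected, open set different from the whole space. -/
def IsProperDomain {n : ℕ} (G : Set (EuclideanSpace ℝ (Fin n))) : Prop :=
  IsOpen G ∧ IsConnected G ∧ G ≠ univ

/-! ### Relations between metrics

All distance functions take values in `[0, ∞]`, so that suprema and infima need no convention.
Only their values at pairs of points of `G` matter. -/

/-- `d ≲ d'` on `G`: there is a finite constant `K > 0` with `d ≤ K d'` on `G × G`. -/
def Dominated {X : Type*} (G : Set X) (d d' : X → X → ℝ≥0∞) : Prop :=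
  ∃ K : ℝ≥0, 0 < K ∧ ∀ x ∈ G, ∀ y ∈ G, d x y ≤ (K : ℝ≥0∞) * d' x y

/-- `d ≈ d'` on `G`: both `d ≲ d'` and `d ≳ d'`. -/
def Equivalent {X : Type*} (G : Set X) (d d' : X → X → ℝ≥0∞) : Prop :=
  Dominated G d d' ∧ Dominated G d' d

/-- `d ≪ d'` on `G`: `d ≲ d'` but not `d ≳ d'`. -/
def StrictlyDominated {X : Type*} (G : Set X) (d d' : X → X → ℝ≥0∞) : Prop :=
  Dominated G d d' ∧ ¬ Dominated G d' d

/-! ### The metrics -/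

/-- The boundary of `G` in the one-point compactification `ℝⁿ ∪ {∞}`. -/
def extBoundary {n : ℕ} (G : Set (EuclideanSpace ℝ (Fin n))) :
    Set (OnePoint (EuclideanSpace ℝ (Fin n))) :=
  frontier (OnePoint.some '' G)

/-- The quotient `|a - y| / |a - x|`, understood to be `1` for `a = ∞`. -/
def distRatio {n : ℕ} (x y : EuclideanSpace ℝ (Fin n))
    (a : OnePoint (EuclideanSpace ℝ (Fin n))) : ℝ :=
  a.elim 1 (fun a => dist a y / dist a x)

/-- The Apollonian metric
`α_G(x, y) = sup_{a, b ∈ ∂G} log (|a - y| |b - x| / (|a - x| |b - y|))`, for `x, y ∈ G`, with the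
boundary taken in `ℝⁿ ∪ {∞}`. Truncating the logarithms at `0` does not change the supremum,
because `a = b` gives the value `0`. -/
def apollonian {n : ℕ} (G : Set (EuclideanSpace ℝ (Fin n))) (x y : EuclideanSpace ℝ (Fin n)) :
    ℝ≥0∞ :=
  ⨆ a ∈ extBoundary G, ⨆ b ∈ extBoundary G,
    ENNReal.ofReal (Real.log (distRatio x y a * distRatio y x b))

/-- The Euclidean distance `δ(x)` from `x` to the boundary of `G`. -/
def bdist {n : ℕ} (G : Set (EuclideanSpace ℝ (Fin n))) (x : EuclideanSpace ℝ (Fin n)) : ℝ :=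
  Metric.infDist x (frontier G)

/-- The metric `j_G(x, y) = log (1 + |x - y| / min {δ(x), δ(y)})`. -/
def jMetric {n : ℕ} (G : Set (EuclideanSpace ℝ (Fin n))) (x y : EuclideanSpace ℝ (Fin n)) :
    ℝ≥0∞ :=
  ENNReal.ofReal (Real.log (1 + dist x y / min (bdist G x) (bdist G y)))

/-- The `d`-length of `γ : [0, 1] → ℝⁿ`: the supremum of `∑_{i < k} d(γ(t_i), γ(t_{i+1}))` over
all `0 = t_0 < t_1 < ⋯ < t_k = 1`. -/
def dLength {n : ℕ} (d : EuclideanSpace ℝ (Fin n) → EuclideanSpace ℝ (Fin n) → ℝ≥0∞)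
    (γ : ℝ → EuclideanSpace ℝ (Fin n)) : ℝ≥0∞ :=
  ⨆ (k : ℕ) (t : ℕ → ℝ) (_ : t 0 = 0 ∧ t k = 1 ∧ ∀ i < k, t i < t (i + 1)),
    ∑ i ∈ Finset.range k, d (γ (t i)) (γ (t (i + 1)))

/-- `γ : [0, 1] → G` is a rectifiable (continuous) path in `G` from `x` to `y`. -/
def IsRectifiablePath {n : ℕ} (G : Set (EuclideanSpace ℝ (Fin n)))
    (x y : EuclideanSpace ℝ (Fin n)) (γ : ℝ → EuclideanSpace ℝ (Fin n)) : Prop :=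
  ContinuousOn γ (Icc 0 1) ∧ eVariationOn γ (Icc 0 1) ≠ ⊤ ∧ MapsTo γ (Icc 0 1) G ∧
    γ 0 = x ∧ γ 1 = y

/-- The inner metric of `d` in `G`: the infimum of the `d`-lengths of the rectifiable paths
joining `x` and `y` in `G`. -/
def innerMetric {n : ℕ} (G : Set (EuclideanSpace ℝ (Fin n)))
    (d : EuclideanSpace ℝ (Fin n) → EuclideanSpace ℝ (Fin n) → ℝ≥0∞)
    (x y : EuclideanSpace ℝ (Fin n)) : ℝ≥0∞ :=
  ⨅ (γ : ℝ → EuclideanSpace ℝ (Fin n)) (_ : IsRectifiablePath G x y γ), dLength d γ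

/-- The Apollonian inner metric. -/
def apollonianInner {n : ℕ} (G : Set (EuclideanSpace ℝ (Fin n)))
    (x y : EuclideanSpace ℝ (Fin n)) : ℝ≥0∞ :=
  innerMetric G (apollonian G) x y

/-- `γ : [0, L] → G` is a path in `G` from `x` to `y`, parameterized by arc length, of length `L`.
(Unit speed means that the part of `γ` over `[s, t]` has length `t - s`; in particular `γ` is
`1`-Lipschitz on `[0, L]`.) -/
def IsArcLengthPath {n : ℕ} (G : Set (EuclideanSpace ℝ (Fin n)))
    (x y : EuclideanSpace ℝ (Fin n)) (L : ℝ) (γ : ℝ → EuclideanSpace ℝ (Fin n)) : Prop :=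
  0 ≤ L ∧ HasUnitSpeedOn γ (Icc 0 L) ∧ MapsTo γ (Icc 0 L) G ∧ γ 0 = x ∧ γ L = y

/-- The quasihyperbolic metric `k_G(x, y) = inf_γ ∫_γ |dz| / δ(z)`. The infimum is over the
rectifiable paths `γ` from `x` to `y` in `G`, and the integral with respect to arc length is
computed in the arc length parameterization of `γ`. -/
def quasihyperbolic {n : ℕ} (G : Set (EuclideanSpace ℝ (Fin n)))
    (x y : EuclideanSpace ℝ (Fin n)) : ℝ≥0∞ :=
  ⨅ (L : ℝ) (γ : ℝ → EuclideanSpace ℝ (Fin n)) (_ : IsArcLengthPath G x y L γ),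
    ∫⁻ t in Icc 0 L, (ENNReal.ofReal (bdist G (γ t)))⁻¹

/-! ### Classes of domains -/

/-- `(G, d)` is `K`-quasi-isotropic:
`limsup_{r → 0+} sup {d(x, z) : |x - z| = r} / inf {d(x, y) : |x - y| = r} ≤ K` for all `x ∈ G`.
The quotient is taken in `[0, ∞]`: it is `∞` if the infimum is `0` and the supremum is not. -/
def IsQuasiIsotropicWith {n : ℕ} (G : Set (EuclideanSpace ℝ (Fin n)))
    (d : EuclideanSpace ℝ (Fin n) → EuclideanSpace ℝ (Fin n) → ℝ≥0∞) (K : ℝ≥0) : Prop :=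
  ∀ x ∈ G,
    limsup (fun r : ℝ => (⨆ z ∈ {z ∈ G | dist x z = r}, d x z) /
      (⨅ y ∈ {y ∈ G | dist x y = r}, d x y)) (𝓝[>] 0) ≤ (K : ℝ≥0∞)

/-- `G` is quasi-isotropic: `(G, α_G)` is `K`-quasi-isotropic for some constant `K`. -/
def IsQuasiIsotropic {n : ℕ} (G : Set (EuclideanSpace ℝ (Fin n))) : Prop :=
  ∃ K : ℝ≥0, IsQuasiIsotropicWith G (apollonian G) K

/-- `G` is uniform: there is a constant `K` such that all `x, y ∈ G` are joined in `G` by a path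
`γ`, parameterized by arc length, with `ℓ(γ) ≤ K |x - y|` and
`K δ(γ(t)) ≥ min {t, ℓ(γ) - t}` for all `t`. -/
def IsUniform {n : ℕ} (G : Set (EuclideanSpace ℝ (Fin n))) : Prop :=
  ∃ K : ℝ, ∀ x ∈ G, ∀ y ∈ G, ∃ (L : ℝ) (γ : ℝ → EuclideanSpace ℝ (Fin n)),
    IsArcLengthPath G x y L γ ∧ L ≤ K * dist x y ∧
      ∀ t ∈ Icc 0 L, min t (L - t) ≤ K * bdist G (γ t)

/-- `G` has the comparison property: `α_G ≈ j_G`. -/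
def HasComparisonProperty {n : ℕ} (G : Set (EuclideanSpace ℝ (Fin n))) : Prop :=
  Equivalent G (apollonian G) (jMetric G)

end HyperbolicType

end

/-! Both assertions reduce to one criterion for `j ≲ α`, `jMetric_dominated_apollonian`; the reverse
bound `α ≤ 2j` is elementary.

With `u` the inversion of a boundary point `a` about `z`, `(|a - z - v| / |a - z|)² = 1 - 2⟨v, u⟩ +
|v|²|u|²`. To first order, then, `α(z, z + v)` is the width in direction `v` of the inverted
boundary. `HasWideBoundary` bounds this width below by `c / δ(z)`. If it failed, some short segment
would have too small an Apollonian length. This contradicts quasi-isotropy, because moving towards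
the nearest boundary point always costs about `|v| / δ(z)`, and it equally contradicts `j ≲ α̃`.

`HasJoiningSets` follows from uniformity, or from `k ≲ j` by integrating `1/δ` with `δ` 1-Lipschitz.

The criterion passes from infinitesimal to finite distances. If `α(x, y)` is small, the boundary
lies near one Apollonian sphere `|w - y| = l |w - x|`. A joining set of `x` and `y` meets this
sphere at some `z`, and inversion about `z` flattens the sphere to a hyperplane. The inverted
boundary thus lies in a thin slab, and its width bounds `|x - y| / δ(x)` by a multiple of `α(x, y)`.
-/

noncomputable section

namespace HyperbolicType

variable {n : ℕ} {G : Set (EuclideanSpace ℝ (Fin n))}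

/-! ### The boundary -/

/-- A preconnected set that meets an open set but not its frontier is contained in it. -/
theorem subset_of_disjoint_frontier {X : Type*} [TopologicalSpace X] {s t : Set X}
    (hs : IsOpen s) (ht : IsPreconnected t) (hne : (t ∩ s).Nonempty)
    (hd : Disjoint t (frontier s)) : t ⊆ s := by
  refine ht.subset_left_of_subset_union hs (isClosed_closure (s := s)).isOpen_compl ?_ ?_ hne
  · exact disjoint_compl_right.mono_left subset_closure |>.mono_right le_rfl
  · intro x hx
    by_cases hxs : x ∈ s
    · exact Or.inl hxs
    · refine Or.inr fun hc => disjoint_left.1 hd hx ?_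
      rw [hs.frontier_eq]
      exact ⟨hc, hxs⟩

theorem coe_mem_extBoundary {a : EuclideanSpace ℝ (Fin n)} :
    (a : OnePoint (EuclideanSpace ℝ (Fin n))) ∈ extBoundary G ↔ a ∈ frontier G := by
  have h := OnePoint.isOpenEmbedding_coe.isOpenMap.preimage_frontier_eq_frontier_preimage
    (OnePoint.continuous_coe (X := EuclideanSpace ℝ (Fin n))) (OnePoint.some '' G)
  rw [preimage_image_eq _ OnePoint.coe_injective] at h
  rw [← h]
  rfl

theorem infty_mem_extBoundary (h : ¬ Bornology.IsBounded G) :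
    OnePoint.infty ∈ extBoundary G := by
  refine ⟨?_, fun hi => OnePoint.infty_notMem_image_coe (interior_subset hi)⟩
  rw [mem_closure_iff_nhds_basis OnePoint.hasBasis_nhds_infty]
  rintro s ⟨-, hs⟩
  have : ¬ G ⊆ s := fun hGs => h (hs.isBounded.subset hGs)
  obtain ⟨x, hxG, hxs⟩ := not_subset.1 this
  exact ⟨x, mem_image_of_mem _ hxG, Or.inl (mem_image_of_mem _ hxs)⟩

theorem IsProperDomain.frontier_nonempty (hG : IsProperDomain G) : (frontier G).Nonempty :=
  nonempty_frontier_iff.2 ⟨hG.2.1.nonempty, hG.2.2⟩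

theorem IsProperDomain.bdist_pos (hG : IsProperDomain G) {x : EuclideanSpace ℝ (Fin n)}
    (hx : x ∈ G) : 0 < bdist G x := by
  refine (isClosed_frontier.notMem_iff_infDist_pos hG.frontier_nonempty).1 fun h => ?_
  rw [hG.1.frontier_eq] at h
  exact h.2 hx

theorem bdist_le_dist {x a : EuclideanSpace ℝ (Fin n)} (ha : a ∈ frontier G) :
    bdist G x ≤ dist a x := by
  rw [dist_comm]
  exact Metric.infDist_le_dist_of_mem ha

theorem bdist_le_add (x y : EuclideanSpace ℝ (Fin n)) : bdist G x ≤ bdist G y + dist x y :=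
  Metric.infDist_le_infDist_add_dist

theorem IsProperDomain.exists_bdist_eq (hG : IsProperDomain G) (x : EuclideanSpace ℝ (Fin n)) :
    ∃ a ∈ frontier G, dist a x = bdist G x := by
  obtain ⟨a, ha, h⟩ := isClosed_frontier.exists_infDist_eq_dist hG.frontier_nonempty x
  exact ⟨a, ha, by rw [dist_comm, ← h]; rfl⟩

theorem IsProperDomain.ball_subset (hG : IsProperDomain G) {x : EuclideanSpace ℝ (Fin n)}
    (hx : x ∈ G) : Metric.ball x (bdist G x) ⊆ G := by
  refine subset_of_disjoint_frontier hG.1 (convex_ball x _).isPreconnected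
    ⟨x, Metric.mem_ball_self (hG.bdist_pos hx), hx⟩ ?_
  exact Metric.disjoint_ball_infDist

/-- Some boundary point is at least as far from `x` as from `y`. -/
theorem IsProperDomain.exists_one_le_distRatio (hG : IsProperDomain G)
    {x y : EuclideanSpace ℝ (Fin n)} (hy : y ∈ G) :
    ∃ b ∈ extBoundary G, 1 ≤ distRatio y x b := by
  by_cases hb : Bornology.IsBounded G
  · by_cases hxy : x = y
    · obtain ⟨a, ha⟩ := hG.frontier_nonempty
      refine ⟨a, coe_mem_extBoundary.2 ha, ?_⟩
      have : 0 < dist a y := (hG.bdist_pos hy).trans_le (bdist_le_dist ha)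
      simp [distRatio, hxy, div_self this.ne']
    · have hD : 0 < dist y x := dist_pos.2 (Ne.symm hxy)
      -- The ray from `y` pointing away from `x` must leave a bounded `G`, and all its points are
      -- farther from `x` than from `y`.
      let f : ℝ → EuclideanSpace ℝ (Fin n) := fun t => y + t • (y - x)
      have hf : Continuous f := by fun_prop
      have hfx : ∀ t : ℝ, 0 ≤ t → dist (f t) y = t * dist y x := by
        intro t ht
        simp [f, dist_eq_norm, norm_smul, abs_of_nonneg ht]
      have hmeet : ¬ Disjoint (f '' Ici 0) (frontier G) := by
        intro hd
        have hsub := subset_of_disjoint_frontier hG.1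
          (isPreconnected_Ici.image f hf.continuousOn)
          ⟨y, ⟨0, by simp, by simp [f]⟩, hy⟩ hd
        obtain ⟨R, hR⟩ := hb.subset_closedBall y
        have hR' : ∀ t : ℝ, 0 ≤ t → t * dist y x ≤ R := fun t ht => by
          rw [← hfx t ht]
          exact hR (hsub (mem_image_of_mem f ht))
        have h0 := hR' 0 le_rfl
        have h1 := hR' ((R + 1) / dist y x) (by rw [zero_mul] at h0; positivity)
        rw [div_mul_cancel₀ _ hD.ne'] at h1
        linarith
      obtain ⟨b, ⟨t, ht, rfl⟩, hbf⟩ := not_disjoint_iff.1 hmeet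
      refine ⟨f t, coe_mem_extBoundary.2 hbf, ?_⟩
      have hpos : 0 < dist (f t) y := (hG.bdist_pos hy).trans_le (bdist_le_dist hbf)
      have ht' : (0 : ℝ) ≤ t := ht
      have h2 : dist (f t) x = (1 + t) * dist y x := by
        have : f t - x = (1 + t) • (y - x) := by simp only [f]; module
        rw [dist_eq_norm, this, norm_smul, Real.norm_of_nonneg (by linarith), dist_eq_norm]
      change 1 ≤ dist (f t) x / dist (f t) y
      rw [one_le_div hpos, h2, hfx t ht']
      nlinarith
  · exact ⟨OnePoint.infty, infty_mem_extBoundary hb, le_rfl⟩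

/-! ### Inverted boundary points -/

/-- The inversion of a point of `ℝⁿ ∪ {∞}` in the unit sphere about `z`, as a vector from `z`. -/
def inversionAt (z : EuclideanSpace ℝ (Fin n)) (a : OnePoint (EuclideanSpace ℝ (Fin n))) :
    EuclideanSpace ℝ (Fin n) :=
  a.elim 0 fun a => (‖a - z‖ ^ 2)⁻¹ • (a - z)

/-- The value of `(|a - p| / |a - z|) ^ 2`, expressed by the inversion of `a` about `z`. -/
def sqRatio (z p : EuclideanSpace ℝ (Fin n)) (a : OnePoint (EuclideanSpace ℝ (Fin n))) : ℝ :=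
  1 - 2 * inner ℝ (p - z) (inversionAt z a) + ‖p - z‖ ^ 2 * ‖inversionAt z a‖ ^ 2

theorem norm_inversionAt_le (hG : IsProperDomain G) {z : EuclideanSpace ℝ (Fin n)} (hz : z ∈ G)
    {a : OnePoint (EuclideanSpace ℝ (Fin n))} (ha : a ∈ extBoundary G) :
    ‖inversionAt z a‖ ≤ (bdist G z)⁻¹ := by
  have hδ := hG.bdist_pos hz
  induction a using OnePoint.rec with
  | infty => simpa [inversionAt] using hδ.le
  | coe a =>
    have h := bdist_le_dist (x := z) (coe_mem_extBoundary.1 ha)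
    rw [dist_eq_norm] at h
    have hpos := hδ.trans_le h
    have : ‖inversionAt z (a : OnePoint (EuclideanSpace ℝ (Fin n)))‖ = ‖a - z‖⁻¹ := by
      simp only [inversionAt, OnePoint.elim_some, norm_smul, norm_inv, norm_pow, norm_norm]
      field_simp
    rw [this]
    exact inv_anti₀ hδ h

theorem sqRatio_coe {z p a : EuclideanSpace ℝ (Fin n)} (h : a ≠ z) :
    sqRatio z p (a : OnePoint (EuclideanSpace ℝ (Fin n))) = (dist a p / dist a z) ^ 2 := by
  have hpos : 0 < ‖a - z‖ := norm_pos_iff.2 (sub_ne_zero.2 h)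
  have h1 : a - p = (a - z) - (p - z) := by abel
  simp only [sqRatio, inversionAt, OnePoint.elim_some, norm_smul, norm_inv, norm_pow, norm_norm,
    inner_smul_right, dist_eq_norm, div_pow]
  rw [h1]
  generalize a - z = w at hpos
  generalize p - z = v
  rw [norm_sub_sq_real, real_inner_comm]
  field_simp

theorem distRatio_pos (hG : IsProperDomain G) {x y : EuclideanSpace ℝ (Fin n)} (hx : x ∈ G)
    (hy : y ∈ G) {a : OnePoint (EuclideanSpace ℝ (Fin n))} (ha : a ∈ extBoundary G) :
    0 < distRatio x y a := by
  induction a using OnePoint.rec with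
  | infty => simp [distRatio]
  | coe a =>
    have h := coe_mem_extBoundary.1 ha
    exact div_pos ((hG.bdist_pos hy).trans_le (bdist_le_dist h))
      ((hG.bdist_pos hx).trans_le (bdist_le_dist h))

theorem distRatio_nonneg (x y : EuclideanSpace ℝ (Fin n))
    (a : OnePoint (EuclideanSpace ℝ (Fin n))) : 0 ≤ distRatio x y a := by
  induction a using OnePoint.rec with
  | infty => simp [distRatio]
  | coe a => exact div_nonneg dist_nonneg dist_nonneg

theorem distRatio_swap (x y : EuclideanSpace ℝ (Fin n))
    (a : OnePoint (EuclideanSpace ℝ (Fin n))) : distRatio y x a = (distRatio x y a)⁻¹ := by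
  induction a using OnePoint.rec with
  | infty => simp [distRatio]
  | coe a => simp [distRatio]

theorem sqRatio_eq (hG : IsProperDomain G) {z p : EuclideanSpace ℝ (Fin n)} (hz : z ∈ G)
    {a : OnePoint (EuclideanSpace ℝ (Fin n))} (ha : a ∈ extBoundary G) :
    sqRatio z p a = distRatio z p a ^ 2 := by
  induction a using OnePoint.rec with
  | infty => simp [distRatio, sqRatio, inversionAt]
  | coe a =>
    have h := coe_mem_extBoundary.1 ha
    exact sqRatio_coe (dist_pos.1 ((hG.bdist_pos hz).trans_le (bdist_le_dist h)))

theorem distRatio_mul (hG : IsProperDomain G) {z x : EuclideanSpace ℝ (Fin n)}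
    (hx : x ∈ G) (y : EuclideanSpace ℝ (Fin n))
    {a : OnePoint (EuclideanSpace ℝ (Fin n))} (ha : a ∈ extBoundary G) :
    distRatio z x a * distRatio x y a = distRatio z y a := by
  induction a using OnePoint.rec with
  | infty => simp [distRatio]
  | coe a =>
    have h := coe_mem_extBoundary.1 ha
    have := (hG.bdist_pos hx).trans_le (bdist_le_dist h)
    simp only [distRatio, OnePoint.elim_some]
    field_simp

/-- Free of quotients, this turns bounds on the ratio for `x, y` into bounds on a combination of two
expressions quadratic in the inverted point. -/
theorem sqRatio_mul (hG : IsProperDomain G) {z x : EuclideanSpace ℝ (Fin n)} (hz : z ∈ G)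
    (hx : x ∈ G) (y : EuclideanSpace ℝ (Fin n))
    {a : OnePoint (EuclideanSpace ℝ (Fin n))} (ha : a ∈ extBoundary G) :
    distRatio x y a ^ 2 * sqRatio z x a = sqRatio z y a := by
  rw [sqRatio_eq hG hz ha (p := x), sqRatio_eq hG hz ha (p := y), ← distRatio_mul (z := z) hG hx y ha]
  ring

/-! ### Elementary estimates for the Apollonian metric -/

theorem log_le_apollonian {x y : EuclideanSpace ℝ (Fin n)}
    {a b : OnePoint (EuclideanSpace ℝ (Fin n))} (ha : a ∈ extBoundary G) (hb : b ∈ extBoundary G) :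
    ENNReal.ofReal (Real.log (distRatio x y a * distRatio y x b)) ≤ apollonian G x y :=
  le_iSup₂_of_le a ha (le_iSup₂_of_le b hb le_rfl)

theorem apollonian_le {x y : EuclideanSpace ℝ (Fin n)} {C : ℝ≥0∞}
    (h : ∀ a ∈ extBoundary G, ∀ b ∈ extBoundary G,
      ENNReal.ofReal (Real.log (distRatio x y a * distRatio y x b)) ≤ C) :
    apollonian G x y ≤ C :=
  iSup₂_le fun a ha => iSup₂_le fun b hb => h a ha b hb

theorem apollonian_comm (x y : EuclideanSpace ℝ (Fin n)) :
    apollonian G x y = apollonian G y x := by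
  refine le_antisymm ?_ ?_ <;>
  · refine apollonian_le fun a ha b hb => ?_
    rw [mul_comm]
    exact log_le_apollonian hb ha

theorem jMetric_comm (x y : EuclideanSpace ℝ (Fin n)) : jMetric G x y = jMetric G y x := by
  rw [jMetric, jMetric, dist_comm, min_comm]

theorem jMetric_of_le {x y : EuclideanSpace ℝ (Fin n)} (h : bdist G x ≤ bdist G y) :
    jMetric G x y = ENNReal.ofReal (Real.log (1 + dist x y / bdist G x)) := by
  rw [jMetric, min_eq_left h]

theorem distRatio_le (hG : IsProperDomain G) {x y : EuclideanSpace ℝ (Fin n)} (hx : x ∈ G)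
    {a : OnePoint (EuclideanSpace ℝ (Fin n))} (ha : a ∈ extBoundary G) :
    distRatio x y a ≤ 1 + dist x y / bdist G x := by
  have hδ := hG.bdist_pos hx
  induction a using OnePoint.rec with
  | infty =>
    simp only [distRatio, OnePoint.elim_infty]
    have : 0 ≤ dist x y / bdist G x := by positivity
    linarith
  | coe a =>
    have h := bdist_le_dist (x := x) (coe_mem_extBoundary.1 ha)
    have hpos := hδ.trans_le h
    simp only [distRatio, OnePoint.elim_some]
    have h1 : dist a y / dist a x ≤ (dist a x + dist x y) / dist a x := by
      gcongr
      exact dist_triangle _ _ _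
    rw [add_div, div_self hpos.ne'] at h1
    have h2 : dist x y / dist a x ≤ dist x y / bdist G x := by gcongr
    linarith

theorem apollonian_dominated_jMetric (hG : IsProperDomain G) :
    Dominated G (apollonian G) (jMetric G) := by
  refine ⟨2, two_pos, fun x hx y hy => ?_⟩
  wlog hxy : bdist G x ≤ bdist G y generalizing x y
  · rw [apollonian_comm, jMetric_comm]
    exact this y hy x hx (le_of_not_ge hxy)
  have hδ := hG.bdist_pos hx
  have hδy := hG.bdist_pos hy
  refine apollonian_le fun a ha b hb => ?_
  rw [jMetric_of_le hxy]
  have ha0 := distRatio_pos hG hx hy ha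
  have hb0 := distRatio_pos hG hy hx hb
  have h1 := distRatio_le hG (y := y) hx ha
  have h2 : distRatio y x b ≤ 1 + dist x y / bdist G x := by
    refine (distRatio_le hG hy hb).trans ?_
    rw [dist_comm]
    gcongr
  have : ((2 : ℝ≥0) : ℝ≥0∞) = ENNReal.ofReal 2 := by simp
  rw [this, ← ENNReal.ofReal_mul zero_le_two]
  refine ENNReal.ofReal_le_ofReal ?_
  rw [Real.log_mul ha0.ne' hb0.ne', two_mul]
  exact add_le_add (Real.log_le_log ha0 h1) (Real.log_le_log hb0 h2)

theorem log_distRatio_le_apollonian (hG : IsProperDomain G) {x y : EuclideanSpace ℝ (Fin n)}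
    (hx : x ∈ G) (hy : y ∈ G) {a : OnePoint (EuclideanSpace ℝ (Fin n))} (ha : a ∈ extBoundary G) :
    ENNReal.ofReal (Real.log (distRatio x y a)) ≤ apollonian G x y := by
  obtain ⟨b, hb, h1⟩ := hG.exists_one_le_distRatio (x := x) hy
  refine le_trans ?_ (log_le_apollonian ha hb)
  have ha0 := distRatio_pos hG hx hy ha
  refine ENNReal.ofReal_le_ofReal (Real.log_le_log ha0 ?_)
  nlinarith

/-! ### A criterion for the comparison property -/

/-- The inversion of the boundary about each point `z` has width at least `c / δ(z)` in every
direction. -/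
def HasWideBoundary (G : Set (EuclideanSpace ℝ (Fin n))) (c : ℝ) : Prop :=
  ∀ z ∈ G, ∀ v : EuclideanSpace ℝ (Fin n), ∃ a ∈ extBoundary G, ∃ b ∈ extBoundary G,
    c * ‖v‖ / bdist G z ≤ inner ℝ v (inversionAt z a - inversionAt z b)

/-- Points at distance comparable with their distance to the boundary are joined in `G` by a
connected set that does not come close to the boundary away from its ends. -/
def HasJoiningSets (G : Set (EuclideanSpace ℝ (Fin n))) (K : ℝ) : Prop :=
  ∀ x ∈ G, ∀ y ∈ G, bdist G x ≤ bdist G y → dist x y ≤ 3 * bdist G x →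
    ∃ S ⊆ G, IsPreconnected S ∧ x ∈ S ∧ y ∈ S ∧
      ∀ z ∈ S, min (dist z x) (dist z y) ≤ K * bdist G z ∧ bdist G z ≤ K * bdist G x

theorem sqRatio_nonneg (hG : IsProperDomain G) {z p : EuclideanSpace ℝ (Fin n)} (hz : z ∈ G)
    {a : OnePoint (EuclideanSpace ℝ (Fin n))} (ha : a ∈ extBoundary G) : 0 ≤ sqRatio z p a := by
  rw [sqRatio_eq hG hz ha]
  positivity

theorem sqRatio_le (hG : IsProperDomain G) {z p : EuclideanSpace ℝ (Fin n)} (hz : z ∈ G)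
    {a : OnePoint (EuclideanSpace ℝ (Fin n))} (ha : a ∈ extBoundary G) :
    sqRatio z p a ≤ (1 + dist z p / bdist G z) ^ 2 := by
  rw [sqRatio_eq hG hz ha]
  have := distRatio_le hG (y := p) hz ha
  have := distRatio_nonneg z p a
  gcongr

/-- If the boundary lies near an Apollonian sphere of `x` and `y` through `z`, then its inversion
about `z` lies in a thin slab. -/
theorem inner_inversionAt_sub_le (hG : IsProperDomain G) {x y z : EuclideanSpace ℝ (Fin n)}
    (hx : x ∈ G) (hy : y ∈ G) (hz : z ∈ G) {l E : ℝ} (hl : 0 < l) (hE : 1 ≤ E)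
    (hzl : dist z y = l * dist z x)
    (hu : ∀ a ∈ extBoundary G, distRatio x y a ≤ E * l)
    (hd : ∀ a ∈ extBoundary G, l ≤ E * distRatio x y a)
    {a b : OnePoint (EuclideanSpace ℝ (Fin n))} (ha : a ∈ extBoundary G) (hb : b ∈ extBoundary G) :
    inner ℝ (l ^ 2 • (x - z) - (y - z)) (inversionAt z a - inversionAt z b) ≤
      l ^ 2 * (E ^ 2 - 1) * (1 + dist z x / bdist G z) ^ 2 := by
  have hq : ‖y - z‖ = l * ‖x - z‖ := by
    rw [← dist_eq_norm, ← dist_eq_norm, dist_comm, hzl, dist_comm z x]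
  have key : ∀ a ∈ extBoundary G,
      |1 - l ^ 2 + 2 * inner ℝ (l ^ 2 • (x - z) - (y - z)) (inversionAt z a)| ≤
        l ^ 2 * (E ^ 2 - 1) * (1 + dist z x / bdist G z) ^ 2 := by
    intro a ha
    have h1 := sqRatio_mul hG hz hx y ha
    -- As `|y - z| = l |x - z|`, the terms in `‖inversionAt z a‖ ^ 2` cancel and an affine function
    -- of the inverted point remains.
    have h2 : 1 - l ^ 2 + 2 * inner ℝ (l ^ 2 • (x - z) - (y - z)) (inversionAt z a) =
        sqRatio z y a - l ^ 2 * sqRatio z x a := by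
      simp only [sqRatio, hq, inner_sub_left, inner_smul_left, conj_trivial]
      ring
    have h3 : |distRatio x y a ^ 2 - l ^ 2| ≤ l ^ 2 * (E ^ 2 - 1) := by
      have hr := distRatio_pos hG hx hy ha
      have hu2 : distRatio x y a ^ 2 ≤ E ^ 2 * l ^ 2 := by
        rw [← mul_pow]; exact pow_le_pow_left₀ hr.le (hu a ha) 2
      have hd2 : l ^ 2 ≤ E ^ 2 * distRatio x y a ^ 2 := by
        rw [← mul_pow]; exact pow_le_pow_left₀ hl.le (hd a ha) 2
      have hE2 : 1 ≤ E ^ 2 := one_le_pow₀ hE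
      rw [abs_le]
      constructor
      · by_contra! hcon
        have h5 : distRatio x y a ^ 2 < l ^ 2 := by nlinarith [sq_nonneg l]
        nlinarith [mul_nonneg (sub_nonneg.2 hE2) (sub_nonneg.2 h5.le)]
      · linarith
    rw [h2, ← h1, ← sub_mul, abs_mul, abs_of_nonneg (sqRatio_nonneg hG hz ha)]
    exact mul_le_mul h3 (sqRatio_le hG hz ha) (sqRatio_nonneg hG hz ha)
      ((abs_nonneg _).trans h3)
  have h1 := (abs_le.1 (key a ha)).2
  have h2 := (abs_le.1 (key b hb)).1
  rw [inner_sub_right]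
  linarith

/-- Both squares expand to the same expression. With `p = x - z` and `q = y - z` the length of the
slab's normal becomes `l |x - y|`, whatever `z` is. -/
theorem norm_apollonian_normal {p q : EuclideanSpace ℝ (Fin n)} {l : ℝ} (hl : 0 ≤ l)
    (h : ‖q‖ = l * ‖p‖) : ‖l ^ 2 • p - q‖ = l * ‖p - q‖ := by
  have : ‖l ^ 2 • p - q‖ ^ 2 = (l * ‖p - q‖) ^ 2 := by
    rw [mul_pow, norm_sub_sq_real, norm_sub_sq_real, norm_smul, inner_smul_left, h]
    simp only [norm_pow, Real.norm_of_nonneg hl, conj_trivial]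
    ring
  exact (pow_left_inj₀ (norm_nonneg _) (by positivity) two_ne_zero).1 this

theorem exp_sq_sub_one_le {A : ℝ} (h0 : 0 ≤ A) (h1 : A ≤ 1) : Real.exp A ^ 2 - 1 ≤ 12 * A := by
  have h2 : Real.exp A ≤ 3 :=
    (Real.exp_le_exp.2 h1).trans (Real.exp_one_lt_d9.le.trans (by norm_num))
  have h3 : Real.exp A - 1 ≤ A * Real.exp A := by
    have := Real.add_one_le_exp (-A)
    have h4 : Real.exp (-A) * Real.exp A = 1 := by rw [← Real.exp_add]; simp
    nlinarith [Real.exp_pos A]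
  have h5 : Real.exp A - 1 ≤ 3 * A := by nlinarith
  have h6 : 0 ≤ Real.exp A - 1 := by linarith [Real.add_one_le_exp A]
  nlinarith

theorem distRatio_le_exp_mul (hG : IsProperDomain G) {x y : EuclideanSpace ℝ (Fin n)}
    (hx : x ∈ G) (hy : y ∈ G) (htop : apollonian G x y ≠ ⊤)
    {a b : OnePoint (EuclideanSpace ℝ (Fin n))} (ha : a ∈ extBoundary G) (hb : b ∈ extBoundary G) :
    distRatio x y a ≤ Real.exp (apollonian G x y).toReal * distRatio x y b := by
  have h := log_le_apollonian (x := x) (y := y) ha hb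
  have ha0 := distRatio_pos hG hx hy ha
  have hb0 := distRatio_pos hG hx hy hb
  rw [ENNReal.ofReal_le_iff_le_toReal htop, distRatio_swap x y b, ← div_eq_mul_inv,
    Real.log_le_iff_le_exp (by positivity), div_le_iff₀ hb0] at h
  exact h

theorem dist_le_of_wide (hG : IsProperDomain G) {c K : ℝ} (hK : 0 < K)
    (hW : HasWideBoundary G c) (hS : HasJoiningSets G K) {x y : EuclideanSpace ℝ (Fin n)}
    (hx : x ∈ G) (hy : y ∈ G) (hxy : bdist G x ≤ bdist G y) (hD : dist x y ≤ 3 * bdist G x)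
    (htop : apollonian G x y ≠ ⊤) :
    c * dist x y ≤
      4 * (1 + K) ^ 2 * K * (Real.exp (apollonian G x y).toReal ^ 2 - 1) * bdist G x := by
  have hδ := hG.bdist_pos hx
  obtain ⟨S, hSG, hSc, hxS, hyS, hS⟩ := hS x hx y hy hxy hD
  -- The Apollonian sphere through the boundary point nearest to `x` has its ratio `l` in `[1, 4]`.
  obtain ⟨a₀, ha₀, had⟩ := hG.exists_bdist_eq x
  set l := distRatio x y (a₀ : OnePoint (EuclideanSpace ℝ (Fin n))) with hl
  have hl' : l = dist a₀ y / bdist G x := by rw [← had]; rfl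
  have ha₀' := coe_mem_extBoundary.2 ha₀
  have hl1 : 1 ≤ l := by
    rw [hl', one_le_div hδ]
    exact hxy.trans (bdist_le_dist ha₀)
  have hl4 : l ≤ 4 := by
    rw [hl', div_le_iff₀ hδ]
    have := dist_triangle a₀ x y
    linarith
  have hl0 : 0 < l := by linarith
  -- The function is nonpositive at `y` and zero or positive at `x`, so the connected set `S` meets
  -- the sphere.
  obtain ⟨z, hzS, hz⟩ : ∃ z ∈ S, dist z y - l * dist z x = 0 := by
    have hcont : ContinuousOn (fun z => dist z y - l * dist z x) S := by fun_prop
    have h := hSc.intermediate_value hyS hxS hcont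
    refine h ⟨?_, ?_⟩
    · simp only [dist_self, zero_sub, Left.neg_nonpos_iff]
      positivity
    · simp
  have hzl : dist z y = l * dist z x := by linarith
  have hzG := hSG hzS
  have hδz := hG.bdist_pos hzG
  obtain ⟨h1, h2⟩ := hS z hzS
  -- Since `l ≥ 1`, `x` is the nearer of the two ends.
  rw [min_eq_left (by rw [hzl]; nlinarith [dist_nonneg (x := z) (y := x)])] at h1
  set E := Real.exp (apollonian G x y).toReal with hE
  have hE1 : 1 ≤ E := Real.one_le_exp ENNReal.toReal_nonneg
  obtain ⟨a, ha, b, hb, hab⟩ := hW z hzG (l ^ 2 • (x - z) - (y - z))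
  have h3 := hab.trans (inner_inversionAt_sub_le hG hx hy hzG hl0 hE1 hzl
    (fun a ha => distRatio_le_exp_mul hG hx hy htop ha ha₀')
    (fun a ha => distRatio_le_exp_mul hG hx hy htop ha₀' ha) ha hb)
  rw [norm_apollonian_normal hl0.le
    (by rw [← dist_eq_norm, ← dist_eq_norm, dist_comm, hzl, dist_comm z x]),
    sub_sub_sub_cancel_right, ← dist_eq_norm, div_le_iff₀ hδz] at h3
  have h4 : dist z x / bdist G z ≤ K := by rwa [div_le_iff₀ hδz]
  have hE2 : 0 ≤ E ^ 2 - 1 := sub_nonneg.2 (one_le_pow₀ hE1)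
  have h5 : l * (c * dist x y) ≤ l * (l * (E ^ 2 - 1) * (1 + K) ^ 2 * bdist G z) := by
    calc l * (c * dist x y) = c * (l * dist x y) := by ring
      _ ≤ _ := h3
      _ ≤ l ^ 2 * (E ^ 2 - 1) * (1 + K) ^ 2 * bdist G z := by gcongr
      _ = _ := by ring
  have h6 := le_of_mul_le_mul_left h5 hl0
  calc c * dist x y ≤ l * (E ^ 2 - 1) * (1 + K) ^ 2 * bdist G z := h6
    _ ≤ 4 * (E ^ 2 - 1) * (1 + K) ^ 2 * (K * bdist G x) := by gcongr
    _ = _ := by ring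

/-- Put `q = |x - y| / δ(x)`. The boundary point nearest to `x` has ratio at least `q - 1`, and `(q
- 1)² ≥ 1 + q` for `q ≥ 3`. -/
theorem jMetric_le_two_mul_apollonian (hG : IsProperDomain G) {x y : EuclideanSpace ℝ (Fin n)}
    (hx : x ∈ G) (hy : y ∈ G) (hD : 3 * bdist G x ≤ dist x y)
    (htop : apollonian G x y ≠ ⊤) :
    Real.log (1 + dist x y / bdist G x) ≤ 2 * (apollonian G x y).toReal := by
  have hδ := hG.bdist_pos hx
  obtain ⟨a, ha, had⟩ := hG.exists_bdist_eq x
  have h := log_distRatio_le_apollonian hG hx hy (coe_mem_extBoundary.2 ha)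
  rw [ENNReal.ofReal_le_iff_le_toReal htop] at h
  refine le_trans ?_ (mul_le_mul_of_nonneg_left h zero_le_two)
  have h3 : 3 ≤ dist x y / bdist G x := by rwa [le_div_iff₀ hδ]
  have h1 : dist x y / bdist G x - 1 ≤ distRatio x y (a : OnePoint (EuclideanSpace ℝ (Fin n))) := by
    change _ ≤ dist a y / dist a x
    rw [had, ← div_self hδ.ne', ← sub_div]
    gcongr
    have := dist_triangle_left x y a
    linarith
  rw [← Real.log_rpow (by linarith)]
  refine Real.log_le_log (by linarith) ?_
  norm_num
  nlinarith

theorem jMetric_dominated_apollonian (hG : IsProperDomain G) {c K : ℝ} (hc : 0 < c) (hK : 0 < K)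
    (hW : HasWideBoundary G c) (hS : HasJoiningSets G K) :
    Dominated G (jMetric G) (apollonian G) := by
  -- Far points need the factor 2. Near points need 3 if `α ≥ 1`, because then `j ≤ 3`. If `α ≤ 1`,
  -- `48 = 4 * 12` combines `dist_le_of_wide` with `exp_sq_sub_one_le`.
  have hM : 0 < 3 + 48 * (1 + K) ^ 2 * K / c := by positivity
  refine ⟨Real.toNNReal (3 + 48 * (1 + K) ^ 2 * K / c), Real.toNNReal_pos.2 hM, fun x hx y hy => ?_⟩
  wlog hxy : bdist G x ≤ bdist G y generalizing x y
  · rw [apollonian_comm, jMetric_comm]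
    exact this y hy x hx (le_of_not_ge hxy)
  have hδ := hG.bdist_pos hx
  by_cases htop : apollonian G x y = ⊤
  · rw [htop, ENNReal.mul_top]
    · exact le_top
    · exact ENNReal.coe_ne_zero.2 (Real.toNNReal_pos.2 hM).ne'
  rw [jMetric_of_le hxy, ← ENNReal.ofReal_toReal htop, ← ENNReal.ofReal, ← ENNReal.ofReal_mul hM.le]
  refine ENNReal.ofReal_le_ofReal ?_
  set A := (apollonian G x y).toReal with hA
  have hA0 : 0 ≤ A := ENNReal.toReal_nonneg
  have hM1 : 0 ≤ 48 * (1 + K) ^ 2 * K / c := by positivity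
  have hq : 0 ≤ dist x y / bdist G x := by positivity
  have hlog : Real.log (1 + dist x y / bdist G x) ≤ dist x y / bdist G x := by
    have := Real.log_le_sub_one_of_pos (x := 1 + dist x y / bdist G x) (by linarith)
    linarith
  rcases le_total (dist x y) (3 * bdist G x) with hD | hD
  · rcases le_total A 1 with hA1 | hA1
    · have h := dist_le_of_wide hG hK hW hS hx hy hxy hD htop
      have h1 : c * dist x y ≤ 4 * (1 + K) ^ 2 * K * (12 * A) * bdist G x := by
        refine h.trans ?_
        have := exp_sq_sub_one_le hA0 hA1
        gcongr
      have h2 : dist x y / bdist G x ≤ 48 * (1 + K) ^ 2 * K / c * A := by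
        rw [div_le_iff₀ hδ, div_mul_eq_mul_div, div_mul_eq_mul_div, le_div_iff₀ hc]
        linarith
      linarith
    · have h3 : dist x y / bdist G x ≤ 3 := by rwa [div_le_iff₀ hδ]
      nlinarith
  · have := jMetric_le_two_mul_apollonian hG hx hy hD htop
    nlinarith

/-! ### The Apollonian metric on short segments -/

/-- First-order expansion of a squared distance ratio along a segment. The error keeps the factor
`|s' - s|`, so that it can be summed over subdivisions. -/
theorem quadratic_quotient_sub_one_le {s s' r k m w : ℝ} (hs : 0 ≤ s) (hsr : s ≤ r) (hs' : 0 ≤ s')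
    (hs'r : s' ≤ r) (hk : 0 ≤ k) (hrk : r * k ≤ 1 / 8) (hm : |m| ≤ k) (hw : 0 ≤ w)
    (hwk : w ≤ k ^ 2) (hP : 0 < 1 - 2 * (s * m) + s ^ 2 * w) :
    ((1 - 2 * (s' * m) + s' ^ 2 * w) / (1 - 2 * (s * m) + s ^ 2 * w) - 1) / 2 ≤
      -(s' - s) * m + 6 * |s' - s| * (r * k ^ 2) := by
  have hr : 0 ≤ r := hs.trans hsr
  have hsm : |s * m| ≤ r * k := by
    rw [abs_mul, abs_of_nonneg hs]
    gcongr
  have hsm' := abs_le.1 hsm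
  have hs2w : 0 ≤ s ^ 2 * w := by positivity
  have hs2w' : s ^ 2 * w ≤ (r * k) ^ 2 := by
    rw [mul_pow]
    gcongr
  have hPge : 3 / 4 ≤ 1 - 2 * (s * m) + s ^ 2 * w := by linarith
  have hrk0 : 0 ≤ r * k := by positivity
  have hP1 : |-(2 * (s * m)) + s ^ 2 * w| ≤ 3 * (r * k) := by
    rw [abs_le]
    constructor <;> nlinarith
  -- This bracket is what remains after clearing the denominator. The denominator is at least `3 /
  -- 4`, and `4 ≤ 6 * (3 / 4)`.
  have hbr : |m * (-(2 * (s * m)) + s ^ 2 * w) + (s + s') * w / 2| ≤ 4 * (r * k ^ 2) := by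
    refine (abs_add_le _ _).trans ?_
    have h1 : |m * (-(2 * (s * m)) + s ^ 2 * w)| ≤ k * (3 * (r * k)) := by
      rw [abs_mul]
      gcongr
    have h2 : |(s + s') * w / 2| ≤ r * k ^ 2 := by
      rw [abs_of_nonneg (by positivity)]
      have : (s + s') * w ≤ (r + r) * k ^ 2 := by gcongr
      linarith
    linarith
  have hmul := mul_le_mul_of_nonneg_left hbr (abs_nonneg (s' - s))
  rw [← abs_mul] at hmul
  have hmul' := (le_abs_self _).trans hmul
  rw [div_le_iff₀ two_pos, sub_le_iff_le_add, div_le_iff₀ hP]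
  have hnn : 0 ≤ |s' - s| * (r * k ^ 2) := by positivity
  nlinarith [mul_le_mul_of_nonneg_left hPge hnn]

theorem IsProperDomain.add_smul_mem (hG : IsProperDomain G) {z θ : EuclideanSpace ℝ (Fin n)}
    (hz : z ∈ G) (hθ : ‖θ‖ = 1) {s : ℝ} (hs : 0 ≤ s) (hsδ : s < bdist G z) : z + s • θ ∈ G := by
  refine hG.ball_subset hz ?_
  simpa [dist_eq_norm, norm_smul, hθ, abs_of_nonneg hs] using hsδ

theorem log_distRatio_le_inner (hG : IsProperDomain G) {z θ : EuclideanSpace ℝ (Fin n)}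
    (hz : z ∈ G) (hθ : ‖θ‖ = 1) {s s' r : ℝ} (hs : 0 ≤ s) (hsr : s ≤ r) (hs' : 0 ≤ s')
    (hs'r : s' ≤ r) (hr : r ≤ bdist G z / 8)
    {a : OnePoint (EuclideanSpace ℝ (Fin n))} (ha : a ∈ extBoundary G) :
    Real.log (distRatio (z + s • θ) (z + s' • θ) a) ≤
      -(s' - s) * inner ℝ θ (inversionAt z a) + 6 * |s' - s| * (r / bdist G z ^ 2) := by
  have hδ := hG.bdist_pos hz
  have hx := hG.add_smul_mem hz hθ hs (by linarith)
  have hy := hG.add_smul_mem hz hθ hs' (by linarith)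
  have hpos := distRatio_pos hG hx hy ha
  have hsq := sqRatio_mul hG hz hx (z + s' • θ) ha
  have hxpos : 0 < sqRatio z (z + s • θ) a := by
    rw [sqRatio_eq hG hz ha]
    exact pow_pos (distRatio_pos hG hz hx ha) 2
  have hexp : ∀ t : ℝ, sqRatio z (z + t • θ) a =
      1 - 2 * (t * inner ℝ θ (inversionAt z a)) + t ^ 2 * ‖inversionAt z a‖ ^ 2 := by
    intro t
    simp [sqRatio, inner_smul_left, norm_smul, hθ]
  have hu := norm_inversionAt_le hG hz ha
  have h1 : Real.log (distRatio (z + s • θ) (z + s' • θ) a) =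
      Real.log (sqRatio z (z + s' • θ) a / sqRatio z (z + s • θ) a) / 2 := by
    rw [← hsq, mul_div_cancel_right₀ _ hxpos.ne', Real.log_pow]
    push_cast
    ring
  have hypos : 0 < sqRatio z (z + s' • θ) a := by rw [← hsq]; positivity
  have h2 := Real.log_le_sub_one_of_pos (div_pos hypos hxpos)
  have h3 := quadratic_quotient_sub_one_le (k := (bdist G z)⁻¹)
    (m := inner ℝ θ (inversionAt z a)) (w := ‖inversionAt z a‖ ^ 2) hs hsr hs' hs'r (by positivity)
    (by rw [← div_eq_mul_inv, div_le_iff₀ hδ]; linarith)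
    ((abs_real_inner_le_norm _ _).trans (by rwa [hθ, one_mul])) (by positivity)
    (pow_le_pow_left₀ (norm_nonneg _) hu 2) (by rwa [← hexp])
  rw [← hexp, ← hexp, inv_pow, ← div_eq_mul_inv] at h3
  rw [h1]
  linarith

/-- The first-order terms at `a` and `b` combine to the width in direction `θ`; the two errors give
`12 = 6 + 6`. Linearity in `s' - s` serves the path length below. -/
theorem apollonian_segment_le (hG : IsProperDomain G) {z θ : EuclideanSpace ℝ (Fin n)}
    (hz : z ∈ G) (hθ : ‖θ‖ = 1) {c ρ : ℝ} (hρ : ρ ≤ 1 / 8)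
    (hc : ∀ a ∈ extBoundary G, ∀ b ∈ extBoundary G,
      inner ℝ θ (inversionAt z a - inversionAt z b) ≤ c / bdist G z)
    {s s' : ℝ} (hs : 0 ≤ s) (hss' : s ≤ s') (hs' : s' ≤ ρ * bdist G z) :
    apollonian G (z + s • θ) (z + s' • θ) ≤
      ENNReal.ofReal ((s' - s) * ((c + 12 * ρ) / bdist G z)) := by
  have hδ := hG.bdist_pos hz
  have hr : ρ * bdist G z ≤ bdist G z / 8 := by
    have := mul_le_mul_of_nonneg_right hρ hδ.le
    linarith
  have hx := hG.add_smul_mem hz hθ hs (by linarith)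
  have hy := hG.add_smul_mem hz hθ (hs.trans hss') (by linarith)
  refine apollonian_le fun a ha b hb => ENNReal.ofReal_le_ofReal ?_
  rw [Real.log_mul (distRatio_pos hG hx hy ha).ne' (distRatio_pos hG hy hx hb).ne']
  have h1 := log_distRatio_le_inner hG hz hθ hs (hss'.trans hs') (hs.trans hss') hs' hr ha
  have h2 := log_distRatio_le_inner hG hz hθ (hs.trans hss') hs' hs (hss'.trans hs') hr hb
  have h3 := mul_le_mul_of_nonneg_left (hc b hb a ha) (sub_nonneg.2 hss')
  have h4 : ρ * bdist G z / bdist G z ^ 2 = ρ / bdist G z := by field_simp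
  rw [abs_sub_comm, abs_of_nonneg (sub_nonneg.2 hss')] at h2
  rw [abs_of_nonneg (sub_nonneg.2 hss')] at h1
  rw [h4] at h1 h2
  rw [inner_sub_right] at h3
  have h5 : (s' - s) * ((c + 12 * ρ) / bdist G z) =
      (s' - s) * (c / bdist G z) + 12 * (s' - s) * (ρ / bdist G z) := by ring
  rw [h5]
  linarith

theorem IsProperDomain.extBoundary_nonempty (hG : IsProperDomain G) : (extBoundary G).Nonempty :=
  hG.frontier_nonempty.elim fun a ha => ⟨a, coe_mem_extBoundary.2 ha⟩

theorem exists_narrow_direction (hG : IsProperDomain G) {c : ℝ} (h : ¬ HasWideBoundary G c) :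
    ∃ z ∈ G, ∃ θ : EuclideanSpace ℝ (Fin n), ‖θ‖ = 1 ∧
      ∀ a ∈ extBoundary G, ∀ b ∈ extBoundary G,
        inner ℝ θ (inversionAt z a - inversionAt z b) ≤ c / bdist G z := by
  unfold HasWideBoundary at h
  push Not at h
  obtain ⟨z, hz, v, hv⟩ := h
  have hv0 : 0 < ‖v‖ := by
    rw [norm_pos_iff]
    rintro rfl
    obtain ⟨a, ha⟩ := hG.extBoundary_nonempty
    simpa using hv a ha a ha
  refine ⟨z, hz, ‖v‖⁻¹ • v, by simp [norm_smul, hv0.ne'], fun a ha b hb => ?_⟩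
  rw [inner_smul_left, conj_trivial, inv_mul_le_iff₀ hv0]
  refine (hv a ha b hb).le.trans_eq ?_
  ring

/-! ### Quasi-isotropic domains -/

/-- Moving the fraction `ρ` of the way to the nearest boundary point changes its distance by the
factor `1 - ρ`, and `-log (1 - ρ) ≥ ρ`. -/
theorem exists_le_apollonian (hG : IsProperDomain G) {z : EuclideanSpace ℝ (Fin n)} (hz : z ∈ G)
    {ρ : ℝ} (h0 : 0 ≤ ρ) (h1 : ρ < 1) :
    ∃ y ∈ G, dist z y = ρ * bdist G z ∧ ENNReal.ofReal ρ ≤ apollonian G z y := by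
  have hδ := hG.bdist_pos hz
  obtain ⟨a, ha, had⟩ := hG.exists_bdist_eq z
  have hza : dist z (z + ρ • (a - z)) = ρ * bdist G z := by
    rw [← had]
    simp [dist_eq_norm, norm_smul, abs_of_nonneg h0]
  have hay : dist a (z + ρ • (a - z)) = (1 - ρ) * bdist G z := by
    rw [← had, dist_eq_norm, dist_eq_norm, ← Real.norm_of_nonneg (sub_nonneg.2 h1.le), ← norm_smul]
    congr 1
    module
  have hy : z + ρ • (a - z) ∈ G := by
    refine hG.ball_subset hz ?_
    rw [Metric.mem_ball, dist_comm, hza]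
    nlinarith
  refine ⟨_, hy, hza, ?_⟩
  rw [apollonian_comm]
  refine le_trans (ENNReal.ofReal_le_ofReal ?_)
    (log_distRatio_le_apollonian hG hy hz (coe_mem_extBoundary.2 ha))
  have h2 : distRatio (z + ρ • (a - z)) z (a : OnePoint (EuclideanSpace ℝ (Fin n))) =
      (1 - ρ)⁻¹ := by
    change dist a z / dist a (z + ρ • (a - z)) = _
    rw [hay, had]
    have : 1 - ρ ≠ 0 := by linarith
    field_simp
  rw [h2, Real.log_inv]
  have := Real.log_le_sub_one_of_pos (sub_pos.2 h1)
  linarith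

theorem IsQuasiIsotropic.hasWideBoundary (hG : IsProperDomain G) (h : IsQuasiIsotropic G) :
    ∃ c > 0, HasWideBoundary G c := by
  obtain ⟨K, hK⟩ := h
  have hK0 : (0 : ℝ) ≤ K := K.2
  -- At scale `ρ` the supremum is at least `ρ`, while a narrow direction gives an infimum of at most
  -- `2cρ`. The quotient would be at least `1 / (2c) = 4(K + 1)`.
  set c : ℝ := 1 / (8 * (K + 1)) with hcdef
  have hc : 0 < c := by positivity
  have hc8 : c ≤ 1 / 8 := by
    rw [hcdef, div_le_div_iff₀ (by positivity) (by positivity)]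
    linarith
  refine ⟨c, hc, ?_⟩
  by_contra hcon
  obtain ⟨z, hz, θ, hθ, hn⟩ := exists_narrow_direction hG hcon
  have hδ := hG.bdist_pos hz
  have hlt : (K : ℝ≥0∞) < ((K + 1 : ℝ≥0) : ℝ≥0∞) := by
    exact_mod_cast lt_add_one K
  have hev := eventually_lt_of_limsup_lt ((hK z hz).trans_lt hlt)
  -- Below this radius the second-order error `12ρ` is at most `c`.
  have hr : ∀ᶠ r : ℝ in 𝓝[>] 0, r ∈ Ioo 0 (c / 12 * bdist G z) :=
    Ioo_mem_nhdsGT (by positivity)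
  obtain ⟨r, hr1, hr0, hrlt⟩ := (hev.and hr).exists
  set ρ := r / bdist G z with hρ
  have hρ0 : 0 < ρ := by positivity
  have hρc : ρ < c / 12 := by rwa [hρ, div_lt_iff₀ hδ]
  have hrρ : r = ρ * bdist G z := by rw [hρ]; field_simp
  obtain ⟨y, hy, hzy, hα⟩ := exists_le_apollonian hG hz hρ0.le (by linarith)
  have hsup : ENNReal.ofReal ρ ≤ ⨆ z' ∈ {z' ∈ G | dist z z' = r}, apollonian G z z' :=
    hα.trans (le_iSup₂_of_le (f := fun z' _ => apollonian G z z') y ⟨hy, by rw [hzy, hrρ]⟩ le_rfl)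
  have hinf : (⨅ y ∈ {y ∈ G | dist z y = r}, apollonian G z y) ≤
      ENNReal.ofReal (ρ * (2 * c)) := by
    have hmem := hG.add_smul_mem hz hθ hr0.le (by nlinarith)
    have hd : dist z (z + r • θ) = r := by simp [norm_smul, hθ, abs_of_pos hr0]
    refine (iInf₂_le (z + r • θ) ⟨hmem, hd⟩).trans ?_
    have h := apollonian_segment_le hG hz hθ (ρ := ρ) (by linarith) hn le_rfl hr0.le hrρ.le
    rw [zero_smul, add_zero, sub_zero] at h
    refine h.trans (ENNReal.ofReal_le_ofReal ?_)
    have h1 : r * ((c + 12 * ρ) / bdist G z) = ρ * (c + 12 * ρ) := by rw [hρ]; ring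
    rw [h1]
    gcongr
    linarith
  -- Since `K + 1` is neither `0` nor `∞`, a degenerate infimum needs no separate case.
  have hle := (ENNReal.div_le_iff_le_mul (Or.inr ENNReal.coe_ne_top)
    (Or.inr (by positivity))).1 hr1.le
  have hfin : ENNReal.ofReal ρ ≤ ENNReal.ofReal ((K + 1) * (ρ * (2 * c))) := by
    refine hsup.trans (hle.trans ?_)
    rw [ENNReal.ofReal_mul (by positivity)]
    have h2 : ((K + 1 : ℝ≥0) : ℝ≥0∞) = ENNReal.ofReal (K + 1) := by
      rw [← ENNReal.ofReal_coe_nnreal]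
      simp
    rw [h2]
    gcongr
  rw [ENNReal.ofReal_le_ofReal_iff (by positivity)] at hfin
  have h3 : ((K : ℝ) + 1) * (ρ * (2 * c)) = ρ / 4 := by
    rw [hcdef]
    field_simp
    norm_num
  rw [h3] at hfin
  linarith

/-! ### Domains whose Apollonian inner metric dominates `j` -/

theorem isRectifiablePath_segment (hG : IsProperDomain G) {z θ : EuclideanSpace ℝ (Fin n)}
    (hz : z ∈ G) (hθ : ‖θ‖ = 1) {r : ℝ} (hr : 0 ≤ r) (hrδ : r < bdist G z) :
    IsRectifiablePath G z (z + r • θ) fun t => z + (t * r) • θ := by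
  refine ⟨by fun_prop, ?_, ?_, by simp, by simp⟩
  · have hL : LipschitzWith (Real.toNNReal r) fun t : ℝ => z + (t * r) • θ := by
      refine LipschitzWith.of_dist_le_mul fun s t => ?_
      rw [dist_add_left, dist_eq_norm, ← sub_smul, norm_smul, hθ, mul_one, ← sub_mul, norm_mul,
        Real.coe_toNNReal r hr, Real.norm_of_nonneg hr, mul_comm, Real.dist_eq, Real.norm_eq_abs]
    have h := hL.locallyBoundedVariationOn (Icc 0 1) 0 1 (by simp) (by simp)
    rwa [inter_self] at h
  · intro t ht
    exact hG.add_smul_mem hz hθ (mul_nonneg ht.1 hr) (by nlinarith [ht.2])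

theorem dLength_segment_le (hG : IsProperDomain G) {z θ : EuclideanSpace ℝ (Fin n)}
    (hz : z ∈ G) (hθ : ‖θ‖ = 1) {c ρ : ℝ} (hc0 : 0 ≤ c) (hρ0 : 0 ≤ ρ) (hρ : ρ ≤ 1 / 8)
    (hc : ∀ a ∈ extBoundary G, ∀ b ∈ extBoundary G,
      inner ℝ θ (inversionAt z a - inversionAt z b) ≤ c / bdist G z) :
    dLength (apollonian G) (fun t => z + (t * (ρ * bdist G z)) • θ) ≤
      ENNReal.ofReal (ρ * (c + 12 * ρ)) := by
  have hδ := hG.bdist_pos hz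
  refine iSup_le fun k => iSup_le fun t => iSup_le fun ⟨ht0, htk, hlt⟩ => ?_
  -- The sequence `t` is unconstrained beyond index `k`.
  have hmono : ∀ j ≤ k, ∀ i ≤ j, t i ≤ t j := by
    intro j
    induction j with
    | zero =>
      intro _ i hi
      rw [Nat.le_zero.1 hi]
    | succ j ih =>
      intro hj i hi
      rcases Nat.le_succ_iff.1 hi with hi | rfl
      · exact (ih (by omega) i hi).trans (hlt j (by omega)).le
      · exact le_rfl
  have hstep : ∀ i ∈ Finset.range k,
      apollonian G (z + (t i * (ρ * bdist G z)) • θ) (z + (t (i + 1) * (ρ * bdist G z)) • θ) ≤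
        ENNReal.ofReal ((t (i + 1) - t i) * (ρ * (c + 12 * ρ))) := by
    intro i hi
    have hik := Finset.mem_range.1 hi
    have hi0 : 0 ≤ t i := ht0 ▸ hmono i hik.le 0 (Nat.zero_le _)
    have hi1 : t (i + 1) ≤ 1 := htk ▸ hmono k le_rfl (i + 1) hik
    have hρδ : 0 ≤ ρ * bdist G z := by positivity
    refine (apollonian_segment_le hG hz hθ hρ hc (mul_nonneg hi0 hρδ)
      (mul_le_mul_of_nonneg_right (hlt i hik).le hρδ)
      (mul_le_of_le_one_left hρδ hi1)).trans_eq ?_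
    congr 1
    field_simp
  refine (Finset.sum_le_sum hstep).trans ?_
  rw [← ENNReal.ofReal_sum_of_nonneg, ← Finset.sum_mul, Finset.sum_range_sub, ht0, htk]
  · simp
  · intro i hi
    have := hlt i (Finset.mem_range.1 hi)
    have : 0 ≤ t (i + 1) - t i := by linarith
    positivity

theorem hasWideBoundary_of_jMetric_dominated (hG : IsProperDomain G)
    (h : Dominated G (jMetric G) (apollonianInner G)) : ∃ c > 0, HasWideBoundary G c := by
  obtain ⟨K, hK0, hK⟩ := h
  have hK0' : (0 : ℝ) < K := hK0
  -- A segment of length `c δ(z)` in a narrow direction has Apollonian length at most `13c²`,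
  -- whereas `j ≥ log (1 + c) ≥ c / 2`. So `26Kc ≥ 1`, which this `c` excludes; the `8` ensures `c ≤
  -- 1 / 8`.
  set c : ℝ := 1 / (8 + 27 * K) with hcdef
  have hc : 0 < c := by positivity
  have hc8 : c ≤ 1 / 8 := by
    rw [hcdef, div_le_div_iff₀ (by positivity) (by positivity)]
    linarith
  refine ⟨c, hc, ?_⟩
  by_contra hcon
  obtain ⟨z, hz, θ, hθ, hn⟩ := exists_narrow_direction hG hcon
  have hδ := hG.bdist_pos hz
  have hr0 : 0 ≤ c * bdist G z := by positivity
  have hrδ : c * bdist G z < bdist G z := by nlinarith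
  have hy := hG.add_smul_mem hz hθ hr0 hrδ
  have h1 : apollonianInner G z (z + (c * bdist G z) • θ) ≤
      ENNReal.ofReal (c * (c + 12 * c)) :=
    (iInf₂_le _ (isRectifiablePath_segment hG hz hθ hr0 hrδ)).trans
      (dLength_segment_le hG hz hθ hc.le hc.le hc8 hn)
  have h2 : ENNReal.ofReal (c / 2) ≤ jMetric G z (z + (c * bdist G z) • θ) := by
    refine ENNReal.ofReal_le_ofReal ?_
    have hm0 : 0 < min (bdist G z) (bdist G (z + (c * bdist G z) • θ)) :=
      lt_min hδ (hG.bdist_pos hy)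
    have hd : dist z (z + (c * bdist G z) • θ) = c * bdist G z := by
      rw [dist_self_add_right, norm_smul, hθ, mul_one, Real.norm_of_nonneg hr0]
    have h3 : c ≤ dist z (z + (c * bdist G z) • θ) /
        min (bdist G z) (bdist G (z + (c * bdist G z) • θ)) := by
      rw [hd, le_div_iff₀ hm0]
      exact mul_le_mul_of_nonneg_left (min_le_left _ _) hc.le
    refine le_trans ?_ (Real.log_le_log (by positivity) (add_le_add_right h3 1))
    refine le_trans ?_ (Real.one_sub_inv_le_log_of_pos (by positivity))
    have h4 : 1 - (1 + c)⁻¹ = c / (1 + c) := by field_simp; ring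
    rw [h4]
    gcongr
    linarith
  have h3 := h2.trans ((hK z hz _ hy).trans (mul_le_mul_right h1 _))
  rw [← ENNReal.ofReal_coe_nnreal, ← ENNReal.ofReal_mul hK0'.le,
    ENNReal.ofReal_le_ofReal_iff (by positivity)] at h3
  have h5 : c * (8 + 27 * K) = 1 := by rw [hcdef]; field_simp
  nlinarith [mul_pos hK0' hc]

/-! ### Joining sets in uniform domains -/

theorem IsArcLengthPath.dist_le {x y : EuclideanSpace ℝ (Fin n)} {L : ℝ}
    {γ : ℝ → EuclideanSpace ℝ (Fin n)} (h : IsArcLengthPath G x y L γ) {s t : ℝ}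
    (hs : s ∈ Icc 0 L) (ht : t ∈ Icc 0 L) (hst : s ≤ t) : dist (γ s) (γ t) ≤ t - s := by
  have h1 := h.2.1 hs ht
  have h2 : edist (γ s) (γ t) ≤ eVariationOn γ (Icc 0 L ∩ Icc s t) :=
    eVariationOn.edist_le γ ⟨hs, le_rfl, hst⟩ ⟨ht, hst, le_rfl⟩
  rw [h1, edist_dist, ENNReal.ofReal_le_ofReal_iff] at h2
  · simpa using h2
  · simpa using hst

theorem IsArcLengthPath.continuousOn {x y : EuclideanSpace ℝ (Fin n)} {L : ℝ}
    {γ : ℝ → EuclideanSpace ℝ (Fin n)} (h : IsArcLengthPath G x y L γ) :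
    ContinuousOn γ (Icc 0 L) := by
  refine (LipschitzOnWith.of_dist_le_mul (K := 1) fun s hs t ht => ?_).continuousOn
  rw [NNReal.coe_one, one_mul, Real.dist_eq]
  rcases le_total s t with hst | hst
  · rw [abs_sub_comm, abs_of_nonneg (sub_nonneg.2 hst)]
    exact h.dist_le hs ht hst
  · rw [abs_of_nonneg (sub_nonneg.2 hst), dist_comm]
    exact h.dist_le ht hs hst

theorem IsArcLengthPath.dist_left_le {x y : EuclideanSpace ℝ (Fin n)} {L : ℝ}
    {γ : ℝ → EuclideanSpace ℝ (Fin n)} (h : IsArcLengthPath G x y L γ) {t : ℝ}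
    (ht : t ∈ Icc 0 L) : dist (γ t) x ≤ t := by
  have := h.dist_le (left_mem_Icc.2 h.1) ht ht.1
  rwa [h.2.2.2.1, sub_zero, dist_comm] at this

theorem IsArcLengthPath.dist_right_le {x y : EuclideanSpace ℝ (Fin n)} {L : ℝ}
    {γ : ℝ → EuclideanSpace ℝ (Fin n)} (h : IsArcLengthPath G x y L γ) {t : ℝ}
    (ht : t ∈ Icc 0 L) : dist (γ t) y ≤ L - t := by
  have := h.dist_le ht (right_mem_Icc.2 h.1) ht.2
  rwa [h.2.2.2.2] at this

theorem IsArcLengthPath.exists_image {x y : EuclideanSpace ℝ (Fin n)} {L : ℝ}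
    {γ : ℝ → EuclideanSpace ℝ (Fin n)} (h : IsArcLengthPath G x y L γ)
    {p : EuclideanSpace ℝ (Fin n) → Prop} (hp : ∀ t ∈ Icc 0 L, p (γ t)) :
    ∃ S ⊆ G, IsPreconnected S ∧ x ∈ S ∧ y ∈ S ∧ ∀ z ∈ S, p z :=
  ⟨γ '' Icc 0 L, h.2.2.1.image_subset, isPreconnected_Icc.image γ h.continuousOn,
    ⟨0, left_mem_Icc.2 h.1, h.2.2.2.1⟩, ⟨L, right_mem_Icc.2 h.1, h.2.2.2.2⟩, by
      rintro _ ⟨t, ht, rfl⟩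
      exact hp t ht⟩

theorem IsUniform.hasJoiningSets (hG : IsProperDomain G) (h : IsUniform G) :
    ∃ K > 0, HasJoiningSets G K := by
  obtain ⟨K, hK⟩ := h
  -- The constant comes from `δ(γ(t)) ≤ δ(x) + L` and `L ≤ 3 |K| δ(x)`.
  refine ⟨1 + 3 * |K|, by positivity, fun x hx y hy _ hD => ?_⟩
  obtain ⟨L, γ, hγ, hL, hmin⟩ := hK x hx y hy
  refine hγ.exists_image fun t ht => ⟨?_, ?_⟩
  · have hδ := hG.bdist_pos (hγ.2.2.1 ht)
    calc min (dist (γ t) x) (dist (γ t) y) ≤ min t (L - t) :=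
          min_le_min (hγ.dist_left_le ht) (hγ.dist_right_le ht)
      _ ≤ K * bdist G (γ t) := hmin t ht
      _ ≤ (1 + 3 * |K|) * bdist G (γ t) := by
          gcongr
          linarith [le_abs_self K, abs_nonneg K]
  · have h1 := bdist_le_add (G := G) (γ t) x
    have h2 := hγ.dist_left_le ht
    have h3 : L ≤ |K| * (3 * bdist G x) :=
      hL.trans (mul_le_mul (le_abs_self K) hD dist_nonneg (abs_nonneg K))
    linarith [ht.2]

/-! ### Joining sets from the quasihyperbolic metric -/

theorem ofReal_integral_inv_le_lintegral {f g : ℝ → ℝ} {t : ℝ} (ht : 0 ≤ t) (hf : Continuous f)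
    (hf0 : ∀ s ∈ Icc 0 t, 0 < f s) (hgf : ∀ s ∈ Icc 0 t, g s ≤ f s) :
    ENNReal.ofReal (∫ s in (0 : ℝ)..t, (f s)⁻¹) ≤ ∫⁻ s in Icc 0 t, (ENNReal.ofReal (g s))⁻¹ := by
  have hcont : ContinuousOn (fun s => (f s)⁻¹) (Icc 0 t) :=
    hf.continuousOn.inv₀ fun s hs => (hf0 s hs).ne'
  rw [intervalIntegral.integral_of_le ht, ← integral_Icc_eq_integral_Ioc,
    ofReal_integral_eq_lintegral_ofReal (hcont.integrableOn_compact isCompact_Icc)]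
  · refine setLIntegral_mono' measurableSet_Icc fun s hs => ?_
    rw [ENNReal.ofReal_inv_of_pos (hf0 s hs)]
    exact ENNReal.inv_le_inv.2 (ENNReal.ofReal_le_ofReal (hgf s hs))
  · exact (ae_restrict_iff' measurableSet_Icc).2
      (Eventually.of_forall fun s hs => (inv_pos.2 (hf0 s hs)).le)

/-- Applied to `δ` along a unit-speed path: being 1-Lipschitz, `δ` grows at most linearly from the
start. The next lemma measures from the end instead. -/
theorem log_le_lintegral_of_le_add {g : ℝ → ℝ} {c t : ℝ} (hc : 0 < c) (ht : 0 ≤ t)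
    (hg : ∀ s ∈ Icc 0 t, g s ≤ c + s) :
    ENNReal.ofReal (Real.log (1 + t / c)) ≤ ∫⁻ s in Icc 0 t, (ENNReal.ofReal (g s))⁻¹ := by
  have h := ofReal_integral_inv_le_lintegral ht (f := fun s => c + s) (by fun_prop)
    (fun s hs => by linarith [hs.1]) hg
  rwa [intervalIntegral.integral_comp_add_left (fun s => s⁻¹) c, add_zero,
    integral_inv_of_pos hc (by linarith), add_div, div_self hc.ne'] at h

theorem log_le_lintegral_of_le_sub {g : ℝ → ℝ} {c t : ℝ} (hc : 0 < c) (ht : 0 ≤ t)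
    (hg : ∀ s ∈ Icc 0 t, g s ≤ c + t - s) :
    ENNReal.ofReal (Real.log (1 + t / c)) ≤ ∫⁻ s in Icc 0 t, (ENNReal.ofReal (g s))⁻¹ := by
  have h := ofReal_integral_inv_le_lintegral ht (f := fun s => c + t - s) (by fun_prop)
    (fun s hs => by linarith [hs.2]) hg
  rwa [intervalIntegral.integral_comp_sub_left (fun s => s⁻¹) (c + t), sub_zero,
    add_sub_cancel_right, integral_inv_of_pos hc (by linarith), add_div, div_self hc.ne'] at h

theorem le_exp_mul_of_log_le {c t T : ℝ} (hc : 0 < c) (ht : 0 ≤ t)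
    (h : Real.log (1 + t / c) ≤ T) : t ≤ Real.exp T * c := by
  have h0 : 0 ≤ t / c := by positivity
  rw [Real.log_le_iff_le_exp (by positivity)] at h
  rw [← div_le_iff₀ hc]
  linarith

/-- A path of quasihyperbolic length below `T` satisfies `t ≤ exp T * δ(x)` and `t ≤ exp T *
δ(γ(t))`, by comparing `δ` with its value at the start and at `γ(t)`. -/
theorem hasJoiningSets_of_quasihyperbolic_dominated (hG : IsProperDomain G)
    (h : Dominated G (quasihyperbolic G) (jMetric G)) : ∃ K > 0, HasJoiningSets G K := by
  obtain ⟨M, -, hM⟩ := h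
  -- Near points have `j ≤ 3`. The extra `1` makes the bound on `k` strict, so that some path
  -- realizes it.
  set T : ℝ := 3 * M + 1 with hT
  have hM0 : (0 : ℝ) ≤ M := M.2
  refine ⟨1 + Real.exp T, by positivity, fun x hx y hy hxy hD => ?_⟩
  have hδ := hG.bdist_pos hx
  have hk : quasihyperbolic G x y < ENNReal.ofReal T := by
    have hj : jMetric G x y ≤ ENNReal.ofReal 3 := by
      rw [jMetric_of_le hxy]
      refine ENNReal.ofReal_le_ofReal ?_
      have h0 : 0 ≤ dist x y / bdist G x := by positivity
      have h1 := Real.log_le_sub_one_of_pos (x := 1 + dist x y / bdist G x) (by linarith)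
      have h3 : dist x y / bdist G x ≤ 3 := by rwa [div_le_iff₀ hδ]
      linarith
    refine ((hM x hx y hy).trans (mul_le_mul_right hj _)).trans_lt ?_
    rw [← ENNReal.ofReal_coe_nnreal, ← ENNReal.ofReal_mul hM0,
      ENNReal.ofReal_lt_ofReal_iff (by positivity)]
    linarith
  simp only [quasihyperbolic, iInf_lt_iff] at hk
  obtain ⟨L, γ, hγ, hlt⟩ := hk
  have hint : ∀ t ∈ Icc 0 L, ∀ c, 0 < c → ENNReal.ofReal (Real.log (1 + t / c)) ≤
      ∫⁻ s in Icc 0 t, (ENNReal.ofReal (bdist G (γ s)))⁻¹ → t ≤ Real.exp T * c := by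
    intro t ht c hc hle
    have h1 := (hle.trans (lintegral_mono_set (Icc_subset_Icc_right ht.2))).trans hlt.le
    rw [ENNReal.ofReal_le_ofReal_iff (by positivity)] at h1
    exact le_exp_mul_of_log_le hc ht.1 h1
  refine hγ.exists_image fun t ht => ⟨?_, ?_⟩
  · have hδz := hG.bdist_pos (hγ.2.2.1 ht)
    have h1 := hint t ht _ hδz (log_le_lintegral_of_le_sub hδz ht.1 fun s hs => by
      have := hγ.dist_le ⟨hs.1, hs.2.trans ht.2⟩ ht hs.2
      linarith [bdist_le_add (G := G) (γ s) (γ t)])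
    exact (min_le_left _ _).trans ((hγ.dist_left_le ht).trans (by linarith))
  · have h1 := hint t ht _ hδ (log_le_lintegral_of_le_add hδ ht.1 fun s hs => by
      have := hγ.dist_left_le ⟨hs.1, hs.2.trans ht.2⟩
      linarith [bdist_le_add (G := G) (γ s) x])
    have h2 := bdist_le_add (G := G) (γ t) x
    have h3 := hγ.dist_left_le ht
    linarith

theorem Dominated.trans {X : Type*} {G : Set X} {d d' d'' : X → X → ℝ≥0∞}
    (h : Dominated G d d') (h' : Dominated G d' d'') : Dominated G d d'' := by
  obtain ⟨K, hK, h⟩ := h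
  obtain ⟨K', hK', h'⟩ := h'
  refine ⟨K * K', mul_pos hK hK', fun x hx y hy => (h x hx y hy).trans ?_⟩
  rw [ENNReal.coe_mul, mul_assoc]
  exact mul_le_mul_right (h' x hx y hy) _

end HyperbolicType

end

theorem mainTheorem1 (n : ℕ) (hn : 2 ≤ n) (G : Set (EuclideanSpace ℝ (Fin n)))
    (hG : HyperbolicType.IsProperDomain G) :
    (HyperbolicType.IsQuasiIsotropic G → HyperbolicType.IsUniform G →
      HyperbolicType.HasComparisonProperty G) ∧
    ¬ (HyperbolicType.StrictlyDominated G
          (HyperbolicType.apollonian G) (HyperbolicType.jMetric G) ∧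
        HyperbolicType.Equivalent G
          (HyperbolicType.jMetric G) (HyperbolicType.apollonianInner G) ∧
        HyperbolicType.Equivalent G
          (HyperbolicType.apollonianInner G) (HyperbolicType.quasihyperbolic G)) := by
  refine ⟨fun hq hu => ?_, ?_⟩
  · obtain ⟨c, hc, hW⟩ := hq.hasWideBoundary hG
    obtain ⟨K, hK, hS⟩ := hu.hasJoiningSets hG
    exact ⟨HyperbolicType.apollonian_dominated_jMetric hG,
      HyperbolicType.jMetric_dominated_apollonian hG hc hK hW hS⟩
  -- `j ≲ α̃` makes the boundary wide, and `k ≲ α̃ ≲ j` gives joining sets. The criterion then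
  -- yields `j ≲ α`, which `α ≪ j` denies.
  · rintro ⟨⟨-, hnot⟩, ⟨hj, hj'⟩, -, hk⟩
    obtain ⟨c, hc, hW⟩ := HyperbolicType.hasWideBoundary_of_jMetric_dominated hG hj
    obtain ⟨K, hK, hS⟩ :=
      HyperbolicType.hasJoiningSets_of_quasihyperbolic_dominated hG (hk.trans hj')
    exact hnot (HyperbolicType.jMetric_dominated_apollonian hG hc hK hW hS)
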